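/- Let $\mathbb T=\mathbb R/2\pi\mathbb Z$, let $V\colon\mathbb T\to\mathbb R$ be smooth, and let $\alpha\in(0,\infty)$, $\tau\in\mathbb R$. For smooth $U\colon\mathbb T\to\mathbb R$ put $Z[U]=\int_{\mathbb T}e^{-V-U}$, $Z=Z[0]$, $\mu_U=e^{-V-U}/Z[U]$, $\mu=\mu_0$ and $\mathcal L_U=e^{V+U}\frac{d}{dx}\bigl(e^{-V-U}\frac{d}{dx}\,\cdot\,\bigr)$. For an observable $f$ with $I=\mu(f)$, let $\phi_{f,U}\in H^1(\mu_U)$, with $\int\phi_{f,U}\,d\mu_U=0$, be the weak solution of the Poisson equation $-\mathcal L_U\phi=(f-I)e^{U}$, and let $$\sigma^2_f[U]=\frac{2Z[U]^2}{Z^2}\int_{\mathbb T}|\phi_{f,U}'|^2\,d\mu_U$$ be the asymptotic variance. Let $J\ge 2$ be even, and let $(f_j,\lambda_j)_{1\le j\le J}$ be the first $J$ eigenfunctions and eigenvalues of $\mathcal K=e^{V}(-\Delta+\tau^2)^{-\alpha}e^{-V}$, regarded as an operator on the space $\{f\in L^2(e^{-2V}):\int_{\mathbb T}fe^{-V}=0\}$.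 That is, the eigenvalues are listed in nonincreasing order with multiplicity, the eigenfunctions are orthogonal in $L^2(e^{-2V})$ and all have the same norm in that space, and no eigenfunction orthogonal to $f_1,\dots,f_J$ has an eigenvalue larger than $\lambda_J$. Let $\sigma^2[U]=\mathbb E\bigl[\sigma^2_f[U]\bigr]$, where $f=\sum_{j=1}^J\sqrt{\lambda_j}\,u_jf_j$ with independent $u_j\sim\mathcal N(0,1)$. Then: 1. For every smooth $U$ and every $u\in\mathbb R^J$, the Poisson equation for $f=\sum_{j}\sqrt{\lambda_j}u_jf_j$ has a solution, unique up to almost everywhere equality, and $\sigma^2_f[U]$ is integrable with respect to the law of $u$, so that $\sigma^2[U]$ is well defined. 2. $U=-V$ is a critical point of $\sigma^2$: for every smooth $\delta U\colon\mathbb T\to\mathbb R$, $$\lim_{\varepsilon\to0}\frac{\sigma^2[-V+\varepsilon\,\delta U]-\sigma^2[-V]}{\varepsilon}=0 .$$ 3. With $m_j=\lceil j/2\rceil$, there are real numbers $a_j,b_j$ such that, almost everywhere, $f_j(x)=e^{V(x)}\bigl(a_j\sin(m_jx)+b_j\cos(m_jx)\bigr)$; the solution of the Poisson equation for $f_j$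 at $U=-V$ is $\phi_j(x)=m_j^{-2}\bigl(a_j\sin(m_jx)+b_j\cos(m_jx)\bigr)$; and $\sum_{j=1}^J\lambda_j|\phi_j'|^2$ is constant on $\mathbb T$. -/

import Mathlib

open MeasureTheory ProbabilityTheory

namespace BiasedLangevin

noncomputable section

instance fact_two_pi_pos : Fact (0 < 2 * Real.pi) := ⟨Real.two_pi_pos⟩

/-- The torus `ℝ / 2πℤ`. Its `volume` is the Lebesgue measure, of total mass `2π`. -/
abbrev Torus : Type := AddCircle (2 * Real.pi)

/-- Smooth real functions on the torus. -/
def IsSmooth (ψ : Torus → ℝ) : Prop :=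
  ContDiff ℝ (⊤ : ℕ∞) (fun x : ℝ => ψ (x : Torus))

/-- The derivative of a function on the torus. -/
def torusDeriv (ψ : Torus → ℝ) (x : Torus) : ℝ :=
  deriv (fun t : ℝ => ψ (x + (t : Torus))) 0

/-- `x ↦ cos (m x)` on the torus. -/
def cosMode (m : ℕ) (x : Torus) : ℝ := (fourier (m : ℤ) x).re

/-- `x ↦ sin (m x)` on the torus. -/
def sinMode (m : ℕ) (x : Torus) : ℝ := (fourier (m : ℤ) x).im

/-! ### Asymptotic variance -/

/-- The normalization constant `Z[U] = ∫ exp (-V - U)`; `Z = Z[0]`. -/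
def partitionFn (V U : Torus → ℝ) : ℝ := ∫ x, Real.exp (-V x - U x)

/-- The probability measure `μ_U` with density `exp (-V - U) / Z[U]`; `μ = μ_0`. -/
def gibbs (V U : Torus → ℝ) : Measure Torus := volume.tilted (fun x => -V x - U x)

/-- `g` is the weak derivative of `φ` on the torus. -/
def HasWeakDeriv (φ g : Torus → ℝ) : Prop :=
  Integrable φ ∧ Integrable g ∧
    ∀ ψ : Torus → ℝ, IsSmooth ψ → ∫ x, φ x * torusDeriv ψ x = -∫ x, g x * ψ x

/-- `φ ∈ H¹(μ_U) ∩ L²₀(μ_U)`, with weak derivative `g`, is a weak solution of the Poisson equation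
`-L_U φ = (f - I) exp U`, where `I = μ(f)` and `L_U = exp (V + U) ∇ · (exp (-V - U) ∇ ·)`. -/
structure IsPoissonSolution (V U f φ g : Torus → ℝ) : Prop where
  memLp : MemLp φ 2 (gibbs V U)
  mean_zero : ∫ x, φ x ∂(gibbs V U) = 0
  weakDeriv : HasWeakDeriv φ g
  memLp_deriv : MemLp g 2 (gibbs V U)
  weak_eq : ∀ ψ : Torus → ℝ, IsSmooth ψ →
    ∫ x, g x * torusDeriv ψ x ∂(gibbs V U) =
      ∫ x, (f x - ∫ y, f y ∂(gibbs V 0)) * Real.exp (U x) * ψ x ∂(gibbs V U)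

open Classical in
/-- The asymptotic variance `σ²_f[U] = 2 Z[U]² / Z² ∫ |∇φ_U|² dμ_U`, where `φ_U` is the solution of
the Poisson equation (and `0` by convention if there is none). -/
def asymVar (V f U : Torus → ℝ) : ℝ :=
  if h : ∃ p : (Torus → ℝ) × (Torus → ℝ), IsPoissonSolution V U f p.1 p.2 then
    2 * partitionFn V U ^ 2 / partitionFn V 0 ^ 2 * ∫ x, h.choose.2 x ^ 2 ∂(gibbs V U)
  else 0

/-- The observable `∑ j, √λ_j u_j f_j` with coefficients `u`. -/
def observable {J : ℕ} (lam : Fin J → ℝ) (f : Fin J → Torus → ℝ) (u : Fin J → ℝ) : Torus → ℝ :=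
  fun x => ∑ j, Real.sqrt (lam j) * u j * f j x

/-- The standard Gaussian measure on `ℝ^J`. -/
def stdGaussian (J : ℕ) : Measure (Fin J → ℝ) := Measure.pi (fun _ => gaussianReal 0 1)

/-- The averaged asymptotic variance `σ²[U]`: the expectation of `σ²_f[U]` for the random observable
`f = ∑ j, √λ_j u_j f_j` with independent `u_j ∼ N(0, 1)`. -/
def avgAsymVar {J : ℕ} (V : Torus → ℝ) (lam : Fin J → ℝ) (f : Fin J → Torus → ℝ)
    (U : Torus → ℝ) : ℝ :=
  ∫ u, asymVar V (observable lam f u) U ∂(stdGaussian J)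

/-- `U` is a critical point of the functional `E`: the directional derivative of `E` at `U` exists
and vanishes in every smooth direction. -/
def IsCriticalPoint (E : (Torus → ℝ) → ℝ) (U : Torus → ℝ) : Prop :=
  ∀ δU : Torus → ℝ, IsSmooth δU →
    HasDerivAt (fun ε : ℝ => E (fun x => U x + ε * δU x)) 0 0

/-! ### The operator `K = exp V (-Δ + τ²)^(-α) exp (-V)` -/

/-- `(-Δ + τ²)^(-α)` on `L²` of the torus, by functional calculus: it multiplies the `k`-th Fourier
coefficient by `(k² + τ²)^(-α)`; the Fourier series is summed in `L²`. (The value of the multiplier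
at `k = 0` does not matter, as the operator is only applied to functions of mean zero.) -/
def invPowLaplacian (τ α : ℝ) (h : Torus → ℝ) : Torus → ℝ := fun x =>
  ((∑' k : ℤ, ((((k : ℝ) ^ 2 + τ ^ 2) ^ (-α) : ℝ) * fourierCoeff (fun y => (h y : ℂ)) k : ℂ) •
    fourierLp 2 k : Lp ℂ 2 (@AddCircle.haarAddCircle (2 * Real.pi) _)) x).re

/-- The operator `K = exp V (-Δ + τ²)^(-α) exp (-V)`. -/
def opK (V : Torus → ℝ) (τ α : ℝ) (f : Torus → ℝ) : Torus → ℝ := fun x =>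
  Real.exp (V x) * invPowLaplacian τ α (fun y => Real.exp (-V y) * f y) x

/-- The space `{f ∈ L²(exp (-2V)) : ∫ f exp (-V) = 0}` on which `K` acts. -/
def MemSpace (V f : Torus → ℝ) : Prop :=
  MemLp f 2 (volume.withDensity (fun x => ENNReal.ofReal (Real.exp (-2 * V x)))) ∧
    ∫ x, f x * Real.exp (-V x) = 0

/-- The inner product of `L²(exp (-2V))`. -/
def innerV (V f g : Torus → ℝ) : ℝ := ∫ x, f x * g x * Real.exp (-2 * V x)

/-- `f` is an eigenfunction of `K` for the eigenvalue `ν`. -/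
structure IsEigenpair (V : Torus → ℝ) (τ α : ℝ) (f : Torus → ℝ) (ν : ℝ) : Prop where
  mem : MemSpace V f
  ne_zero : ¬ f =ᵐ[volume] 0
  eigen : opK V τ α f =ᵐ[volume] fun x => ν * f x

/-- `(f j, lam j)` are the first `J` eigenpairs of `K`: eigenvalues are listed in nonincreasing
order with multiplicity, the eigenfunctions are orthogonal in `L²(exp (-2V))` and have a common norm
(so orthonormal up to a common factor), and no eigenfunction orthogonal to all of them has a larger
eigenvalue. -/
structure IsFirstEigenpairs {J : ℕ} (V : Torus → ℝ) (τ α : ℝ) (f : Fin J → Torus → ℝ)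
    (lam : Fin J → ℝ) : Prop where
  eigenpair : ∀ j, IsEigenpair V τ α (f j) (lam j)
  antitone : Antitone lam
  orthogonal : ∀ i j, i ≠ j → innerV V (f i) (f j) = 0
  norm_eq : ∀ i j, innerV V (f i) (f i) = innerV V (f j) (f j)
  first : ∀ (g : Torus → ℝ) (ν : ℝ), IsEigenpair V τ α g ν →
    (∀ j, innerV V (f j) g = 0) → ∀ j, ν ≤ lam j

end

end BiasedLangevin

/-!
Integrating the Poisson equation once gives `φ' = exp (V + U) (G - ν(G))`, where `G' = -exp (-V) f`
and `ν` is the probability measure with density proportional to `exp (V + U)`. Hence `σ²_f[U]` is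
`2 Z[U] Y[U] / Z²` times the variance of `G` under `ν`, with `Y[U] = ∫ exp (V + U)`.

The eigenfunctions are `exp V` times sinusoids, and since `J` is even they come in orthogonal pairs
of equal norm and frequency. By `sin² + cos² = 1`, the sum `∑ λ_j G_j²` is therefore a constant `C`,
and averaging over the Gaussian coefficients turns the variance into `C - ∑ λ_j ν(G_j)²`.

Along `U = -V + ε δU` put `A(ε) = ∫ exp (ε δU)`. The prefactor is a multiple of `A(ε) A(-ε)`, which
is even in `ε`, and the means `ν(G_j)` vanish at `ε = 0`, so `σ²` has derivative zero there.
-/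

namespace BiasedLangevin

/-! ### Continuous functions on compact measure spaces -/

section Compact

variable {X : Type*} [MeasurableSpace X] {μ : Measure X} {p : ENNReal}

theorem integral_tilted_eq_inv_mul (u h : X → ℝ) :
    ∫ x, h x ∂(μ.tilted u) = (∫ x, Real.exp (u x) ∂μ)⁻¹ * ∫ x, Real.exp (u x) * h x ∂μ := by
  rw [integral_tilted, ← integral_const_mul]
  congr with x
  rw [smul_eq_mul]
  ring

variable [TopologicalSpace X] [CompactSpace X]

theorem memLp_withDensity_of_continuous {w h : X → ℝ} (hw : Continuous w) (hh : MemLp h p μ) :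
    MemLp h p (μ.withDensity fun x => ENNReal.ofReal (w x)) := by
  obtain ⟨C, hC⟩ := isCompact_univ.exists_bound_of_continuousOn hw.continuousOn
  refine hh.of_measure_le_smul (c := ENNReal.ofReal C) ENNReal.ofReal_ne_top ?_
  rw [← withDensity_const]
  exact withDensity_mono (.of_forall fun x => ENNReal.ofReal_le_ofReal
    ((le_abs_self _).trans (hC x trivial)))

variable [OpensMeasurableSpace X]

theorem memLp_of_continuous [IsFiniteMeasure μ] {u : X → ℝ} (hu : Continuous u) (p : ENNReal) :
    MemLp u p μ := by
  obtain ⟨C, hC⟩ := isCompact_univ.exists_bound_of_continuousOn hu.continuousOn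
  exact MemLp.of_bound hu.aestronglyMeasurable C (.of_forall fun x => hC x trivial)

theorem integrable_of_continuous [IsFiniteMeasure μ] {u : X → ℝ} (hu : Continuous u) :
    Integrable u μ :=
  (memLp_of_continuous hu 1).integrable le_rfl

theorem memLp_continuous_mul [IsFiniteMeasure μ] {w h : X → ℝ} (hw : Continuous w)
    (hh : MemLp h p μ) : MemLp (fun x => w x * h x) p μ :=
  hh.mul (memLp_of_continuous hw ⊤)

theorem memLp_withDensity_iff {w h : X → ℝ} (hw : Continuous w) (hpos : ∀ x, 0 < w x) :
    MemLp h p (μ.withDensity fun x => ENNReal.ofReal (w x)) ↔ MemLp h p μ := by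
  refine ⟨fun hh => ?_, memLp_withDensity_of_continuous hw⟩
  have hinv : MemLp h p ((μ.withDensity fun x => ENNReal.ofReal (w x)).withDensity
      fun x => (ENNReal.ofReal (w x))⁻¹) := by
    convert memLp_withDensity_of_continuous (hw.inv₀ fun x => (hpos x).ne') hh using 3 with x
    exact (ENNReal.ofReal_inv_of_pos (hpos x)).symm
  rwa [withDensity_inv_same hw.measurable.ennreal_ofReal
    (.of_forall fun x => (ENNReal.ofReal_pos.2 (hpos x)).ne')
    (.of_forall fun _ => ENNReal.ofReal_ne_top)] at hinv

theorem memLp_tilted_iff [IsFiniteMeasure μ] {u h : X → ℝ} (hu : Continuous u) :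
    MemLp h p (μ.tilted u) ↔ MemLp h p μ := by
  rcases eq_or_ne μ 0 with rfl | hμ
  · simp
  have : NeZero μ := ⟨hμ⟩
  have hexp : Integrable (fun x => Real.exp (u x)) μ := integrable_of_continuous (by fun_prop)
  exact memLp_withDensity_iff (by fun_prop)
    fun x => div_pos (Real.exp_pos _) (integral_exp_pos hexp)

theorem hasDerivAt_integral_exp_mul [IsFiniteMeasure μ] {w h : X → ℝ} (hw : Continuous w)
    (hh : Continuous h) (t : ℝ) :
    HasDerivAt (fun s : ℝ => ∫ x, Real.exp (s * w x) * h x ∂μ)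
      (∫ x, w x * Real.exp (t * w x) * h x ∂μ) t := by
  obtain ⟨C, hC⟩ := isCompact_univ.exists_bound_of_continuousOn
    (f := fun q : X => |w q| * Real.exp ((|t| + 1) * |w q|) * |h q|) (by fun_prop)
  refine (hasDerivAt_integral_of_dominated_loc_of_deriv_le (bound := fun _ => C)
    (F := fun s x => Real.exp (s * w x) * h x)
    (F' := fun s x => w x * Real.exp (s * w x) * h x)
    (Metric.ball_mem_nhds t one_pos) (.of_forall fun s => ?_)
    (integrable_of_continuous (by fun_prop)) ?_ (.of_forall fun x s hs => ?_)
    (integrable_const C) (.of_forall fun x s _ => ?_)).2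
  · exact Continuous.aestronglyMeasurable (by fun_prop)
  · exact Continuous.aestronglyMeasurable (by fun_prop)
  · have hst : |s| ≤ |t| + 1 := by
      have := abs_sub_abs_le_abs_sub s t
      have := (Real.dist_eq s t ▸ Metric.mem_ball.1 hs).le
      linarith
    have hexp : s * w x ≤ (|t| + 1) * |w x| :=
      (le_abs_self _).trans ((abs_mul _ _).trans_le (by gcongr))
    refine le_trans ?_ ((le_abs_self _).trans (hC x trivial))
    rw [Real.norm_eq_abs, abs_mul, abs_mul, Real.abs_exp]
    gcongr
  · have := (((hasDerivAt_id s).mul_const (w x)).exp).mul_const (h x)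
    simpa [mul_comm] using this

end Compact

/-! ### Calculus on the torus -/

/-- `u'` is the classical derivative of the `C¹` function `u` on the torus; antiderivatives of
functions which are merely continuous are not `IsSmooth`, so both are needed. -/
structure HasTorusDeriv (u u' : Torus → ℝ) : Prop where
  continuous_deriv : Continuous u'
  hasDerivAt : ∀ t : ℝ, HasDerivAt (fun s : ℝ => u (s : Torus)) (u' (t : Torus)) t

theorem continuous_torus_iff {u : Torus → ℝ} :
    Continuous u ↔ Continuous fun s : ℝ => u (s : Torus) :=
  (QuotientAddGroup.isQuotientMap_mk (N := AddSubgroup.zmultiples (2 * Real.pi))).continuous_iff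

theorem integral_torus_eq (u : Torus → ℝ) :
    ∫ x, u x = ∫ t in (0 : ℝ)..2 * Real.pi, u (t : Torus) := by
  rw [← AddCircle.intervalIntegral_preimage (2 * Real.pi) 0 u, zero_add]

theorem torusDeriv_coe (ψ : Torus → ℝ) (t : ℝ) :
    torusDeriv ψ (t : Torus) = deriv (fun s : ℝ => ψ (s : Torus)) t := by
  simpa [torusDeriv] using deriv_comp_const_add (f := fun s : ℝ => ψ (s : Torus)) t 0

theorem IsSmooth.hasTorusDeriv {ψ : Torus → ℝ} (h : IsSmooth ψ) :
    HasTorusDeriv ψ (torusDeriv ψ) where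
  continuous_deriv := by
    simp_rw [continuous_torus_iff, torusDeriv_coe]
    exact ContDiff.continuous_deriv h (by simp)
  hasDerivAt t := by
    rw [torusDeriv_coe]
    exact (ContDiff.differentiable h (by simp) t).hasDerivAt

theorem isSmooth_const (c : ℝ) : IsSmooth fun _ => c :=
  contDiff_const

namespace HasTorusDeriv

variable {u u' v v' : Torus → ℝ}

theorem continuous (h : HasTorusDeriv u u') : Continuous u :=
  continuous_torus_iff.2 <| continuous_iff_continuousAt.2 fun t => (h.hasDerivAt t).continuousAt

theorem torusDeriv_eq (h : HasTorusDeriv u u') : torusDeriv u = u' := by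
  ext x
  obtain ⟨t, rfl⟩ := QuotientAddGroup.mk_surjective x
  exact (torusDeriv_coe u t).trans (h.hasDerivAt t).deriv

theorem add_const (h : HasTorusDeriv u u') (c : ℝ) : HasTorusDeriv (fun x => u x + c) u' where
  continuous_deriv := h.continuous_deriv
  hasDerivAt t := (h.hasDerivAt t).add_const c

theorem const_mul (c : ℝ) (h : HasTorusDeriv u u') :
    HasTorusDeriv (fun x => c * u x) (fun x => c * u' x) where
  continuous_deriv := h.continuous_deriv.const_mul c
  hasDerivAt t := (h.hasDerivAt t).const_mul c

theorem sum {ι : Type*} {s : Finset ι} {u u' : ι → Torus → ℝ}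
    (h : ∀ i ∈ s, HasTorusDeriv (u i) (u' i)) :
    HasTorusDeriv (fun x => ∑ i ∈ s, u i x) (fun x => ∑ i ∈ s, u' i x) where
  continuous_deriv := continuous_finsetSum _ fun i hi => (h i hi).continuous_deriv
  hasDerivAt t := HasDerivAt.fun_sum fun i hi => (h i hi).hasDerivAt t

theorem integral_mul (hu : HasTorusDeriv u u') (hv : HasTorusDeriv v v') :
    ∫ x, u x * v' x = -∫ x, u' x * v x := by
  have hperiod : ((2 * Real.pi : ℝ) : Torus) = ((0 : ℝ) : Torus) := by simp
  rw [integral_torus_eq, integral_torus_eq, intervalIntegral.integral_mul_deriv_eq_deriv_mul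
    (fun t _ => hu.hasDerivAt t) (fun t _ => hv.hasDerivAt t)
    ((continuous_torus_iff.1 hu.continuous_deriv).intervalIntegrable _ _)
    ((continuous_torus_iff.1 hv.continuous_deriv).intervalIntegrable _ _), hperiod]
  ring

theorem hasWeakDeriv (h : HasTorusDeriv u u') : HasWeakDeriv u u' :=
  ⟨integrable_of_continuous h.continuous, integrable_of_continuous h.continuous_deriv,
    fun _ hψ => h.integral_mul hψ.hasTorusDeriv⟩

end HasTorusDeriv

theorem IsSmooth.continuous {ψ : Torus → ℝ} (h : IsSmooth ψ) : Continuous ψ :=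
  h.hasTorusDeriv.continuous

theorem exists_hasTorusDeriv {g : Torus → ℝ} (hg : Continuous g) (h0 : ∫ x, g x = 0) :
    ∃ φ : Torus → ℝ, HasTorusDeriv φ g := by
  have hc := continuous_torus_iff.1 hg
  have hg_periodic : Function.Periodic (fun t : ℝ => g (t : Torus)) (2 * Real.pi) :=
    fun t => by simp
  have hφ_periodic :
      Function.Periodic (fun t : ℝ => ∫ s in (0 : ℝ)..t, g (s : Torus)) (2 * Real.pi) := by
    intro t
    have hmean := hg_periodic.intervalIntegral_add_eq t 0
    rw [zero_add, ← integral_torus_eq, h0] at hmean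
    dsimp only
    rw [← intervalIntegral.integral_add_adjacent_intervals (hc.intervalIntegrable 0 t)
      (hc.intervalIntegrable t (t + 2 * Real.pi)), hmean, add_zero]
  refine ⟨hφ_periodic.lift, hg, fun t => ?_⟩
  simp only [Function.Periodic.lift_coe]
  exact (hc.integral_hasStrictDerivAt 0 t).hasDerivAt

/-! ### Fourier coefficients of real functions -/

section Fourier

variable {T : ℝ} [hT : Fact (0 < T)]

/-- The `k`-th Fourier coefficient of a real function, with respect to the probability measure on
the circle. -/
noncomputable def realFourierCoeff (h : AddCircle T → ℝ) (k : ℤ) : ℂ :=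
  fourierCoeff (fun y => (h y : ℂ)) k

theorem ae_haarAddCircle_iff {p : AddCircle T → Prop} :
    (∀ᵐ x ∂AddCircle.haarAddCircle, p x) ↔ ∀ᵐ x, p x := by
  rw [AddCircle.volume_eq_smul_haarAddCircle, Measure.ae_ennreal_smul_measure_iff]
  simpa using hT.out

theorem fourierCoeff_conj (h : AddCircle T → ℂ) (k : ℤ) :
    fourierCoeff (fun y => starRingEnd ℂ (h y)) k = starRingEnd ℂ (fourierCoeff h (-k)) := by
  unfold fourierCoeff
  rw [← integral_conj]
  congr with t
  rw [smul_eq_mul, smul_eq_mul, map_mul, ← fourier_neg, neg_neg]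

theorem ae_eq_of_fourierCoeff {h g : AddCircle T → ℂ} (hh : MemLp h 2 AddCircle.haarAddCircle)
    (hg : MemLp g 2 AddCircle.haarAddCircle) (heq : ∀ k, fourierCoeff h k = fourierCoeff g k) :
    h =ᵐ[AddCircle.haarAddCircle] g := by
  refine (MemLp.toLp_eq_toLp_iff hh hg).1 (fourierBasis.repr.injective ?_)
  ext k
  rw [fourierBasis_repr, fourierBasis_repr, fourierCoeff_congr_ae hh.coeFn_toLp,
    fourierCoeff_congr_ae hg.coeFn_toLp, heq]

theorem realFourierCoeff_congr {h g : AddCircle T → ℝ} (hg : h =ᵐ[volume] g) :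
    realFourierCoeff h = realFourierCoeff g :=
  fourierCoeff_congr_ae (ae_haarAddCircle_iff.2 (hg.fun_comp Complex.ofReal))

theorem realFourierCoeff_zero (h : AddCircle T → ℝ) :
    realFourierCoeff h 0 = (T⁻¹ * ∫ x, h x : ℝ) := by
  simp only [realFourierCoeff, fourierCoeff, neg_zero, fourier_zero, smul_eq_mul,
    one_mul, AddCircle.integral_haarAddCircle, integral_complex_ofReal,
    Complex.ofReal_mul]

theorem realFourierCoeff_neg (h : AddCircle T → ℝ) (k : ℤ) :
    realFourierCoeff h (-k) = starRingEnd ℂ (realFourierCoeff h k) := by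
  simpa only [realFourierCoeff, Complex.conj_ofReal, neg_neg]
    using fourierCoeff_conj (fun y => (h y : ℂ)) (-k)

theorem realFourierCoeff_const_mul (c : ℝ) (h : AddCircle T → ℝ) (k : ℤ) :
    realFourierCoeff (fun x => c * h x) k = c * realFourierCoeff h k := by
  unfold realFourierCoeff
  rw [← fourierCoeff.const_mul]
  simp only [Complex.ofReal_mul]

theorem realFourierCoeff_re {h : AddCircle T → ℂ} (hh : Integrable h AddCircle.haarAddCircle)
    (k : ℤ) : realFourierCoeff (fun x => (h x).re) k =
      (fourierCoeff h k + starRingEnd ℂ (fourierCoeff h (-k))) / 2 := by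
  have hconj : Integrable (fun x => starRingEnd ℂ (h x)) AddCircle.haarAddCircle :=
    (Complex.conjCLE.integrable_comp_iff).2 hh
  have hre : (fun x => ((h x).re : ℂ)) = fun x => (1 / 2 : ℂ) * (h x + starRingEnd ℂ (h x)) := by
    ext x
    rw [Complex.re_eq_add_conj]
    ring
  rw [realFourierCoeff, hre, fourierCoeff.const_mul, ← fourierCoeff_conj]
  rw [show (fun x => h x + starRingEnd ℂ (h x)) = h + fun x => starRingEnd ℂ (h x) from rfl,
    fourierCoeff.add hh hconj, Pi.add_apply]
  ring

theorem ae_eq_of_realFourierCoeff_natCast {h g : AddCircle T → ℝ} (hh : MemLp h 2)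
    (hg : MemLp g 2) (heq : ∀ k : ℕ, realFourierCoeff h k = realFourierCoeff g k) :
    h =ᵐ[volume] g := by
  have hcoeff : ∀ k : ℤ, realFourierCoeff h k = realFourierCoeff g k := by
    intro k
    obtain ⟨m, rfl | rfl⟩ := k.eq_nat_or_neg
    · exact heq m
    · rw [realFourierCoeff_neg, realFourierCoeff_neg, heq]
  have hae := ae_eq_of_fourierCoeff (memLp_haarAddCircle_iff.2 hh.ofReal)
    (memLp_haarAddCircle_iff.2 hg.ofReal) hcoeff
  exact (ae_haarAddCircle_iff.1 hae).mono fun x hx => Complex.ofReal_injective hx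

theorem ae_eq_zero_iff_realFourierCoeff_natCast {h : AddCircle T → ℝ} (hh : MemLp h 2) :
    h =ᵐ[volume] 0 ↔ ∀ k : ℕ, realFourierCoeff h k = 0 := by
  have hzero (k : ℤ) : realFourierCoeff (0 : AddCircle T → ℝ) k = 0 := by
    simp [realFourierCoeff, fourierCoeff]
  refine ⟨fun h0 k => by rw [realFourierCoeff_congr h0, hzero], fun h0 => ?_⟩
  exact ae_eq_of_realFourierCoeff_natCast hh .zero fun k => by rw [h0, hzero]

end Fourier

/-! ### Trigonometric functions -/

/-- The real trigonometric function of frequency `n` with complex amplitude `c`, that is,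
`x ↦ -Im c * sin (n x) + Re c * cos (n x)`. -/
noncomputable def trig (n : ℤ) (c : ℂ) (x : Torus) : ℝ := (c * fourier n x).re

theorem trig_natCast (m : ℕ) (c : ℂ) (x : Torus) :
    trig m c x = -c.im * sinMode m x + c.re * cosMode m x := by
  rw [trig, Complex.mul_re, sinMode, cosMode]
  ring

theorem trig_natCast_I_mul (m : ℕ) (c : ℂ) (x : Torus) :
    trig m (Complex.I * c) x = -c.im * cosMode m x - c.re * sinMode m x := by
  simp only [trig_natCast, Complex.I_mul_im, Complex.I_mul_re]
  ring

theorem trig_zero (c : ℂ) (x : Torus) : trig 0 c x = c.re := by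
  simp [trig]

theorem isSmooth_trig (n : ℤ) (c : ℂ) : IsSmooth (trig n c) := by
  unfold IsSmooth trig
  simp_rw [fourier_coe_apply]
  have hofReal : ContDiff ℝ (⊤ : ℕ∞) ((↑) : ℝ → ℂ) := Complex.ofRealCLM.contDiff
  have hexp : ContDiff ℝ (⊤ : ℕ∞) fun t : ℝ =>
      c * Complex.exp (2 * Real.pi * Complex.I * n * t / (2 * Real.pi : ℝ)) := by fun_prop
  exact Complex.reCLM.contDiff.comp hexp

theorem hasTorusDeriv_trig (n : ℤ) (c : ℂ) :
    HasTorusDeriv (trig n c) fun x => n * trig n (Complex.I * c) x where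
  continuous_deriv := (isSmooth_trig n _).hasTorusDeriv.continuous.const_mul _
  hasDerivAt t := by
    have hderiv := ((hasDerivAt_fourier (2 * Real.pi) n t).const_mul c)
    refine (Complex.reCLM.hasFDerivAt.comp_hasDerivAt t hderiv).congr_deriv ?_
    have : (Real.pi : ℂ) ≠ 0 := by exact_mod_cast Real.pi_ne_zero
    rw [Complex.reCLM_apply, trig, ← Complex.re_ofReal_mul]
    congr 1
    push_cast
    field_simp

theorem memLp_trig (n : ℤ) (c : ℂ) (p : ENNReal) : MemLp (trig n c) p :=
  memLp_of_continuous (hasTorusDeriv_trig n c).continuous p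

theorem realFourierCoeff_trig (n k : ℤ) (c : ℂ) :
    realFourierCoeff (trig n c) k =
      ((if k = n then c else 0) + (if k = -n then starRingEnd ℂ c else 0)) / 2 := by
  have hint : Integrable (fun x : Torus => c * fourier n x) AddCircle.haarAddCircle :=
    (Continuous.integrable_of_hasCompactSupport (by fun_prop) (.of_compactSpace _))
  have hcoeff (k : ℤ) : fourierCoeff (fun x : Torus => c * fourier n x) k =
      if k = n then c else 0 := by
    rw [fourierCoeff.const_mul, fourierCoeff_fourier, Pi.single_apply, mul_ite, mul_one, mul_zero]
  rw [show trig n c = fun x => (c * fourier n x).re from rfl, realFourierCoeff_re hint, hcoeff,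
    hcoeff, apply_ite (starRingEnd ℂ), map_zero]
  simp only [neg_eq_iff_eq_neg]

theorem realFourierCoeff_trig_natCast {n : ℕ} (hn : n ≠ 0) (m : ℕ) (c : ℂ) :
    realFourierCoeff (trig n c) m = if m = n then c / 2 else 0 := by
  rw [realFourierCoeff_trig, if_neg (show ¬ (m : ℤ) = -n by omega), add_zero, ite_div, zero_div]
  simp only [Nat.cast_inj]

theorem integral_mul_trig {h : Torus → ℝ} (hh : MemLp h 2) (n : ℤ) (c : ℂ) :
    ∫ x, h x * trig n c x = 2 * Real.pi * (starRingEnd ℂ c * realFourierCoeff h n).re := by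
  have hint : Integrable (fun x : Torus => c * (fourier n x • (h x : ℂ)))
      AddCircle.haarAddCircle :=
    (((memLp_haarAddCircle_iff.2 hh.ofReal).integrable one_le_two).fourier_smul n).const_mul c
  have hre (x : Torus) : h x * trig n c x = (c * (fourier n x • (h x : ℂ))).re := by
    rw [trig, smul_eq_mul, ← mul_assoc, Complex.re_mul_ofReal, mul_comm]
  have hvol : ∫ x, h x * trig n c x =
      2 * Real.pi * ∫ x : Torus, h x * trig n c x ∂AddCircle.haarAddCircle := by
    rw [AddCircle.integral_haarAddCircle, smul_eq_mul, mul_inv_cancel_left₀ Real.two_pi_pos.ne']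
  have hcoeff : ∫ x : Torus, h x * trig n c x ∂AddCircle.haarAddCircle =
      (c * realFourierCoeff h (-n)).re := by
    simp_rw [hre, realFourierCoeff, fourierCoeff, neg_neg, ← integral_const_mul]
    exact integral_re hint
  rw [hvol, hcoeff, realFourierCoeff_neg, ← Complex.conj_re, map_mul, Complex.conj_conj]

theorem integral_trig_mul_trig {n m : ℕ} (hm : m ≠ 0) (c d : ℂ) :
    ∫ x, trig n c x * trig m d x = if n = m then Real.pi * inner ℝ c d else 0 := by
  rw [integral_mul_trig (memLp_trig n c 2), realFourierCoeff_trig]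
  have hneg : ¬ (m : ℤ) = -n := by omega
  by_cases hnm : n = m
  · subst hnm
    rw [if_pos rfl, if_neg hneg, if_pos rfl, add_zero, mul_div_assoc', Complex.div_ofNat_re,
      real_inner_comm, Complex.inner, mul_comm c]
    ring
  · rw [if_neg (by omega), if_neg hneg, if_neg hnm]
    simp only [add_zero, zero_div, mul_zero, Complex.zero_re]

theorem exists_ae_eq_trig {h : Torus → ℝ} (hh : MemLp h 2) (n : ℕ)
    (h0 : ∀ m : ℕ, m ≠ n → realFourierCoeff h m = 0) : ∃ c : ℂ, h =ᵐ[volume] trig n c := by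
  refine ⟨if n = 0 then realFourierCoeff h 0 else 2 * realFourierCoeff h n,
    ae_eq_of_realFourierCoeff_natCast hh (memLp_trig _ _ 2) fun m => ?_⟩
  rw [realFourierCoeff_trig]
  by_cases hmn : m = n
  · subst hmn
    by_cases hm : m = 0
    · have hreal : starRingEnd ℂ (realFourierCoeff h 0) = realFourierCoeff h 0 := by
        rw [← realFourierCoeff_neg, neg_zero]
      simp [hm, hreal]
    · rw [if_pos rfl, if_neg hm, if_neg (by omega)]
      ring
  · rw [h0 m hmn, if_neg (by omega), if_neg (by omega)]
    ring

theorem ae_eq_const_of_integral_mul_torusDeriv {w : Torus → ℝ} (hw : MemLp w 2)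
    (h : ∀ ψ, IsSmooth ψ → ∫ x, w x * torusDeriv ψ x = 0) :
    ∃ c : ℝ, w =ᵐ[volume] fun _ => c := by
  have hzero : ∀ m : ℕ, m ≠ 0 → realFourierCoeff w m = 0 := by
    intro m hm
    have hre (c : ℂ) : (starRingEnd ℂ (Complex.I * c) * realFourierCoeff w m).re = 0 := by
      have := h _ (isSmooth_trig m c)
      rw [(hasTorusDeriv_trig m c).torusDeriv_eq] at this
      simp_rw [mul_left_comm (w _)] at this
      rw [integral_const_mul, integral_mul_trig hw] at this
      simpa [hm, Real.pi_ne_zero] using this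
    apply Complex.ext
    · simpa using hre Complex.I
    · simpa using hre 1
  obtain ⟨c, hc⟩ := exists_ae_eq_trig hw 0 hzero
  exact ⟨c.re, hc.trans (.of_forall (trig_zero c))⟩

/-! ### The operator `K` and its eigenpairs -/

/-- The Fourier multiplier of `(-Δ + τ²)^(-α)`. -/
noncomputable def multiplier (τ α : ℝ) (k : ℤ) : ℝ := ((k : ℝ) ^ 2 + τ ^ 2) ^ (-α)

section Multiplier

variable {τ α : ℝ}

theorem multiplier_nonneg (τ α : ℝ) (k : ℤ) : 0 ≤ multiplier τ α k := by
  unfold multiplier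
  positivity

theorem multiplier_neg (τ α : ℝ) (k : ℤ) : multiplier τ α (-k) = multiplier τ α k := by
  simp only [multiplier, Int.cast_neg, even_two.neg_pow]

theorem multiplier_strictAntiOn (τ : ℝ) (hα : 0 < α) :
    StrictAntiOn (fun m : ℕ => multiplier τ α m) (Set.Ioi 0) := by
  intro m hm n _ hmn
  have hm' : (0 : ℝ) < m := by exact_mod_cast hm
  refine Real.rpow_lt_rpow_of_neg ?_ ?_ (neg_lt_zero.2 hα) <;> simp only [Int.cast_natCast]
  · positivity
  · gcongr

theorem multiplier_le (τ : ℝ) (hα : 0 ≤ α) (k : ℤ) :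
    multiplier τ α k ≤ 1 + multiplier τ α 0 := by
  by_cases hk : k = 0
  · subst hk
    linarith
  have hone : (1 : ℝ) ≤ (k : ℝ) ^ 2 + τ ^ 2 := by
    have : (1 : ℝ) ≤ (k : ℝ) ^ 2 := by exact_mod_cast (show 0 < k ^ 2 by positivity)
    nlinarith [sq_nonneg τ]
  have : multiplier τ α k ≤ 1 := Real.rpow_le_one_of_one_le_of_nonpos hone (neg_nonpos.2 hα)
  linarith [multiplier_nonneg τ α 0]

variable {h : Torus → ℝ}

theorem memℓp_multiplier_mul_realFourierCoeff (τ : ℝ) (hα : 0 ≤ α) (hh : MemLp h 2) :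
    Memℓp (fun k => (multiplier τ α k * realFourierCoeff h k : ℂ)) 2 := by
  have hL := memLp_haarAddCircle_iff.2 hh.ofReal
  have hsq : Summable fun k => ‖realFourierCoeff h k‖ ^ 2 := by
    have := (hasSum_sq_fourierCoeff hL.toLp).summable
    rwa [fourierCoeff_congr_ae hL.coeFn_toLp] at this
  refine memℓp_gen ?_
  simp only [ENNReal.toReal_ofNat, Real.rpow_ofNat]
  refine .of_nonneg_of_le (fun _ => by positivity) (fun k => ?_)
    (hsq.mul_left ((1 + multiplier τ α 0) ^ 2))
  rw [norm_mul, mul_pow, Complex.norm_real, Real.norm_of_nonneg (multiplier_nonneg _ _ _)]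
  gcongr
  · exact multiplier_nonneg _ _ _
  · exact multiplier_le τ hα k

theorem exists_invPowLaplacian_eq_re (τ : ℝ) (hα : 0 ≤ α) (hh : MemLp h 2) :
    ∃ S : Lp ℂ 2 (AddCircle.haarAddCircle : Measure Torus),
      (invPowLaplacian τ α h = fun x => (S x).re) ∧
      ∀ k, fourierCoeff S k = multiplier τ α k * realFourierCoeff h k := by
  have hmem := memℓp_multiplier_mul_realFourierCoeff τ hα hh
  refine ⟨fourierBasis.repr.symm ⟨_, hmem⟩, ?_, fun k => ?_⟩
  · ext x
    rw [← (fourierBasis.hasSum_repr_symm ⟨_, hmem⟩).tsum_eq, coe_fourierBasis]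
    rfl
  · rw [← fourierBasis_repr, LinearIsometryEquiv.apply_symm_apply]

theorem memLp_invPowLaplacian (τ : ℝ) (hα : 0 ≤ α) (hh : MemLp h 2) :
    MemLp (invPowLaplacian τ α h) 2 := by
  obtain ⟨S, hS, -⟩ := exists_invPowLaplacian_eq_re τ hα hh
  rw [hS]
  exact (memLp_haarAddCircle_iff.1 (Lp.memLp S)).re

theorem realFourierCoeff_invPowLaplacian (τ : ℝ) (hα : 0 ≤ α) (hh : MemLp h 2) (k : ℤ) :
    realFourierCoeff (invPowLaplacian τ α h) k = multiplier τ α k * realFourierCoeff h k := by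
  obtain ⟨S, hS, hcoeff⟩ := exists_invPowLaplacian_eq_re τ hα hh
  rw [hS, realFourierCoeff_re ((Lp.memLp S).integrable one_le_two), hcoeff, hcoeff,
    multiplier_neg, realFourierCoeff_neg, map_mul, Complex.conj_ofReal, Complex.conj_conj]
  ring

theorem invPowLaplacian_ae_eq_const_mul_iff (τ : ℝ) (hα : 0 ≤ α) (hh : MemLp h 2) (ν : ℝ) :
    (invPowLaplacian τ α h =ᵐ[volume] fun x => ν * h x) ↔
      ∀ m : ℕ, multiplier τ α m * realFourierCoeff h m = ν * realFourierCoeff h m := by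
  simp_rw [← realFourierCoeff_invPowLaplacian τ hα hh, ← realFourierCoeff_const_mul]
  exact ⟨fun hae m => congrFun (realFourierCoeff_congr hae) m,
    ae_eq_of_realFourierCoeff_natCast (memLp_invPowLaplacian τ hα hh) (hh.const_mul ν)⟩

end Multiplier

section Eigenpairs

variable {V : Torus → ℝ} {τ α ν : ℝ} {g : Torus → ℝ}

theorem exp_neg_mul_exp_mul (v t : ℝ) : Real.exp (-v) * (Real.exp v * t) = t := by
  rw [← mul_assoc, ← Real.exp_add, neg_add_cancel, Real.exp_zero, one_mul]

theorem memSpace_exp_mul_iff (hV : Continuous V) :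
    MemSpace V (fun x => Real.exp (V x) * g x) ↔ MemLp g 2 ∧ realFourierCoeff g 0 = 0 := by
  have hmem : MemLp (fun x => Real.exp (V x) * g x) 2 ↔ MemLp g 2 := by
    refine ⟨fun hg => ?_, fun hg => memLp_continuous_mul (by fun_prop) hg⟩
    simpa only [exp_neg_mul_exp_mul] using
      memLp_continuous_mul (w := fun x => Real.exp (-V x)) (by fun_prop) hg
  rw [MemSpace, memLp_withDensity_iff (by fun_prop) fun x => Real.exp_pos _, hmem,
    realFourierCoeff_zero, Complex.ofReal_eq_zero, mul_eq_zero_iff_left (by positivity)]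
  simp only [mul_comm (_ * g _), exp_neg_mul_exp_mul]

theorem isEigenpair_exp_mul_iff (hV : Continuous V) (hα : 0 ≤ α) :
    IsEigenpair V τ α (fun x => Real.exp (V x) * g x) ν ↔
      (MemLp g 2 ∧ realFourierCoeff g 0 = 0) ∧ ¬ g =ᵐ[volume] 0 ∧
        ∀ m : ℕ, multiplier τ α m * realFourierCoeff g m = ν * realFourierCoeff g m := by
  have hzero : (fun x => Real.exp (V x) * g x) =ᵐ[volume] 0 ↔ g =ᵐ[volume] 0 := by
    simp only [Filter.EventuallyEq, Pi.zero_apply, mul_eq_zero, Real.exp_ne_zero, false_or]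
  have heigen : opK V τ α (fun x => Real.exp (V x) * g x) =ᵐ[volume]
      (fun x => ν * (Real.exp (V x) * g x)) ↔
        invPowLaplacian τ α g =ᵐ[volume] fun x => ν * g x := by
    simp only [Filter.EventuallyEq, opK, exp_neg_mul_exp_mul, mul_left_comm ν, mul_eq_mul_left_iff,
      Real.exp_ne_zero, or_false]
  rw [← memSpace_exp_mul_iff hV, ← hzero]
  constructor
  · rintro ⟨hmem, hne, heq⟩
    exact ⟨hmem, hne, (invPowLaplacian_ae_eq_const_mul_iff τ hα
      ((memSpace_exp_mul_iff hV).1 hmem).1 ν).1 (heigen.1 heq)⟩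
  · rintro ⟨hmem, hne, heq⟩
    exact ⟨hmem, hne, heigen.2 <| (invPowLaplacian_ae_eq_const_mul_iff τ hα
      ((memSpace_exp_mul_iff hV).1 hmem).1 ν).2 heq⟩

theorem IsEigenpair.exists_trig (hV : Continuous V) (hα : 0 < α) {f : Torus → ℝ}
    (h : IsEigenpair V τ α f ν) :
    ∃ (n : ℕ) (c : ℂ), 0 < n ∧ c ≠ 0 ∧ ν = multiplier τ α n ∧
      f =ᵐ[volume] fun x => Real.exp (V x) * trig n c x := by
  set g : Torus → ℝ := fun x => Real.exp (-V x) * f x with hg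
  have hfg : f = fun x => Real.exp (V x) * g x := by
    ext x
    simpa only [neg_neg] using (exp_neg_mul_exp_mul (-V x) (f x)).symm
  rw [hfg, isEigenpair_exp_mul_iff hV hα.le] at h
  obtain ⟨⟨hL, hzero⟩, hne, heigen⟩ := h
  have hν {m : ℕ} (hm : realFourierCoeff g m ≠ 0) : multiplier τ α m = ν := by
    exact_mod_cast mul_right_cancel₀ hm (heigen m)
  have hpos {m : ℕ} (hm : realFourierCoeff g m ≠ 0) : 0 < m :=
    Nat.pos_of_ne_zero fun h0 => hm (h0 ▸ hzero)
  obtain ⟨n, hn⟩ : ∃ n : ℕ, realFourierCoeff g n ≠ 0 := by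
    by_contra! hall
    exact hne ((ae_eq_zero_iff_realFourierCoeff_natCast hL).2 hall)
  obtain ⟨c, hc⟩ := exists_ae_eq_trig hL n fun m hmn => by
    by_contra hm
    exact hmn ((multiplier_strictAntiOn τ hα).injOn (hpos hm) (hpos hn)
      ((hν hm).trans (hν hn).symm))
  refine ⟨n, c, hpos hn, ?_, (hν hn).symm, ?_⟩
  · rintro rfl
    exact hne (hc.trans (.of_forall fun x => by simp [trig]))
  · rw [hfg]
    exact hc.mono fun x hx => congrArg (Real.exp (V x) * ·) hx

theorem isEigenpair_trig (hV : Continuous V) (τ : ℝ) (hα : 0 ≤ α) {n : ℕ} (hn : n ≠ 0) {c : ℂ}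
    (hc : c ≠ 0) :
    IsEigenpair V τ α (fun x => Real.exp (V x) * trig n c x) (multiplier τ α n) := by
  refine (isEigenpair_exp_mul_iff hV hα).2 ⟨⟨memLp_trig n c 2, ?_⟩, fun h0 => ?_, fun m => ?_⟩
  · simpa [hn.symm] using realFourierCoeff_trig_natCast hn 0 c
  · have := (ae_eq_zero_iff_realFourierCoeff_natCast (memLp_trig n c 2)).1 h0 n
    rw [realFourierCoeff_trig_natCast hn, if_pos rfl] at this
    exact div_ne_zero hc two_ne_zero this
  · rw [realFourierCoeff_trig_natCast hn]
    split_ifs with hmn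
    · rw [hmn]
    · simp only [mul_zero]

theorem innerV_trig {f g : Torus → ℝ} {n m : ℕ} (hm : m ≠ 0) {c d : ℂ}
    (hf : f =ᵐ[volume] fun x => Real.exp (V x) * trig n c x)
    (hg : g =ᵐ[volume] fun x => Real.exp (V x) * trig m d x) :
    innerV V f g = if n = m then Real.pi * inner ℝ c d else 0 := by
  rw [← integral_trig_mul_trig hm]
  refine integral_congr_ae ?_
  filter_upwards [hf, hg] with x hfx hgx
  have hexp : Real.exp (V x) * Real.exp (V x) * Real.exp (-2 * V x) = 1 := by
    rw [← Real.exp_add, ← Real.exp_add, ← Real.exp_zero]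
    ring_nf
  rw [hfx, hgx]
  linear_combination (trig n c x * trig m d x) * hexp

end Eigenpairs

/-! ### Orthogonal families -/

section Orthogonal

variable {ι E : Type*} [Fintype ι] [NormedAddCommGroup E] [InnerProductSpace ℝ E]

theorem exists_ne_zero_forall_inner_eq_zero [FiniteDimensional ℝ E]
    (hcard : Fintype.card ι < Module.finrank ℝ E) (v : ι → E) :
    ∃ w : E, w ≠ 0 ∧ ∀ i, inner ℝ (v i) w = 0 := by
  have hspan : Submodule.span ℝ (Set.range v) ≠ ⊤ := fun htop =>
    ((finrank_range_le_card v).trans_lt hcard).ne (by rw [Set.finrank, htop, finrank_top])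
  obtain ⟨w, hw, hw0⟩ := Submodule.exists_mem_ne_zero_of_ne_bot
    (mt Submodule.orthogonal_eq_bot_iff.1 hspan)
  exact ⟨w, hw0, fun i => hw _ (Submodule.subset_span (Set.mem_range_self i))⟩

theorem sum_sq_inner_of_orthogonal [FiniteDimensional ℝ E]
    (hcard : Fintype.card ι = Module.finrank ℝ E) {v : ι → E} {r : ℝ}
    (hnorm : ∀ i, ‖v i‖ = r) (horth : Pairwise fun i j => inner ℝ (v i) (v j) = 0) (w : E) :
    ∑ i, inner ℝ (v i) w ^ 2 = r ^ 2 * ‖w‖ ^ 2 := by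
  rcases eq_or_ne r 0 with rfl | hr
  · simp [fun i => norm_eq_zero.1 (hnorm i)]
  have hr_nonneg (i : ι) : 0 ≤ r := hnorm i ▸ norm_nonneg _
  have hon : Orthonormal ℝ fun i => r⁻¹ • v i := by
    refine ⟨fun i => ?_, fun i j hij => ?_⟩
    · rw [norm_smul, hnorm, norm_inv, Real.norm_of_nonneg (hr_nonneg i), inv_mul_cancel₀ hr]
    · simp only [inner_smul_left, inner_smul_right, horth hij, mul_zero]
  have hspan : ⊤ ≤ Submodule.span ℝ (Set.range fun i => r⁻¹ • v i) :=
    (hon.linearIndependent.span_eq_top_of_card_eq_finrank' hcard).ge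
  rw [← (OrthonormalBasis.mk hon hspan).sum_sq_inner_right w, Finset.mul_sum]
  refine Finset.sum_congr rfl fun i _ => ?_
  rw [OrthonormalBasis.coe_mk, real_inner_smul_left]
  field_simp

theorem card_le_finrank_of_orthogonal [FiniteDimensional ℝ E] {v : ι → E} (hne : ∀ i, v i ≠ 0)
    (horth : Pairwise fun i j => inner ℝ (v i) (v j) = 0) :
    Fintype.card ι ≤ Module.finrank ℝ E :=
  (linearIndependent_of_ne_zero_of_inner_eq_zero hne horth).fintype_card_le_finrank

theorem inner_I_mul_I_mul (z w : ℂ) :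
    inner ℝ (Complex.I * z) (Complex.I * w) = inner ℝ z w := by
  rw [Complex.inner, Complex.inner, map_mul, Complex.conj_I]
  congr 1
  linear_combination (-(w * starRingEnd ℂ z)) * Complex.I_sq

theorem sum_sq_trig_of_orthogonal (hcard : Fintype.card ι = 2) {c : ι → ℂ} {r : ℝ}
    (hnorm : ∀ i, ‖c i‖ = r) (horth : Pairwise fun i j => inner ℝ (c i) (c j) = 0)
    (n : ℤ) (x : Torus) : ∑ i, trig n (c i) x ^ 2 = r ^ 2 := by
  have hinner (z : ℂ) : trig n z x = inner ℝ z (star (fourier n x)) := by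
    simp [trig, Complex.inner, mul_comm]
  simp_rw [hinner]
  rw [sum_sq_inner_of_orthogonal (hcard.trans Complex.finrank_real_complex.symm) hnorm horth,
    norm_star, fourier_apply, Circle.norm_coe, one_pow, mul_one]

end Orthogonal

theorem eq_half_add_one_of_card_fiber {J : ℕ} {n : Fin J → ℕ} (hn : Monotone n)
    (hpos : ∀ j, 0 < n j) (hle : ∀ m, (Finset.univ.filter fun i => n i = m).card ≤ 2)
    (hge : ∀ m j, 0 < m → m < n j → 2 ≤ (Finset.univ.filter fun i => n i = m).card)
    (j : Fin J) : n j = j / 2 + 1 := by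
  have hupper : (j : ℕ) + 1 ≤ 2 * n j := by
    have := Finset.card_le_mul_card_image_of_maps_to (s := Finset.Iic j)
      (t := Finset.Icc 1 (n j)) (f := n)
      (fun i hi => Finset.mem_Icc.2 ⟨hpos i, hn (Finset.mem_Iic.1 hi)⟩) 2
      fun m _ => (Finset.card_le_card (Finset.filter_subset_filter _ (Finset.subset_univ _))).trans
        (hle m)
    simpa only [Fin.card_Iic, Nat.card_Icc, add_tsub_cancel_right] using this
  have hlower : 2 * (n j - 1) ≤ j := by
    have := Finset.mul_card_image_le_card_of_maps_to
      (s := Finset.univ.filter fun i => n i < n j) (t := Finset.Ico 1 (n j)) (f := n)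
      (fun i hi => Finset.mem_Ico.2 ⟨hpos i, (Finset.mem_filter.1 hi).2⟩) 2 fun m hm => by
        obtain ⟨hm0, hmj⟩ := Finset.mem_Ico.1 hm
        refine (hge m j hm0 hmj).trans (Finset.card_le_card fun i hi => ?_)
        simp only [Finset.mem_filter, Finset.mem_univ, true_and] at hi ⊢
        exact ⟨hi ▸ hmj, hi⟩
    rw [Nat.card_Ico] at this
    refine this.trans ((Finset.card_le_card fun i hi => ?_).trans (Fin.card_Iio j).le)
    exact Finset.mem_Iio.2 (hn.reflect_lt (Finset.mem_filter.1 hi).2)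
  have := hpos j
  lia

/-! ### The first eigenpairs -/

/-- The eigenpairs `(f j, lam j)` in explicit form: `f j = exp V · Re (c j exp (i n_j x))`, and
`lam j` is the multiplier at the frequency `n j`. -/
structure HasTrigForm {J : ℕ} (V : Torus → ℝ) (τ α : ℝ) (f : Fin J → Torus → ℝ)
    (lam : Fin J → ℝ) (n : Fin J → ℕ) (c : Fin J → ℂ) : Prop where
  freq_pos : ∀ j, 0 < n j
  coeff_ne_zero : ∀ j, c j ≠ 0
  lam_eq : ∀ j, lam j = multiplier τ α (n j)
  ae_eq : ∀ j, f j =ᵐ[volume] fun x => Real.exp (V x) * trig (n j) (c j) x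

section FirstEigenpairs

variable {J : ℕ} {V : Torus → ℝ} {τ α : ℝ} {f : Fin J → Torus → ℝ} {lam : Fin J → ℝ}
  {n : Fin J → ℕ} {c : Fin J → ℂ}

theorem IsFirstEigenpairs.exists_hasTrigForm (h : IsFirstEigenpairs V τ α f lam)
    (hV : Continuous V) (hα : 0 < α) : ∃ n c, HasTrigForm V τ α f lam n c := by
  choose n c hn hc hlam hf using fun j => (h.eigenpair j).exists_trig hV hα
  exact ⟨n, c, hn, hc, hlam, hf⟩

namespace HasTrigForm

theorem innerV_eq (ht : HasTrigForm V τ α f lam n c) (i j : Fin J) :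
    innerV V (f i) (f j) = if n i = n j then Real.pi * inner ℝ (c i) (c j) else 0 :=
  innerV_trig (ht.freq_pos j).ne' (ht.ae_eq i) (ht.ae_eq j)

theorem inner_coeff_eq_zero (ht : HasTrigForm V τ α f lam n c)
    (h : IsFirstEigenpairs V τ α f lam) {i j : Fin J} (hij : i ≠ j) (hn : n i = n j) :
    inner ℝ (c i) (c j) = 0 := by
  have := h.orthogonal i j hij
  rwa [ht.innerV_eq, if_pos hn, mul_eq_zero_iff_left Real.pi_ne_zero] at this

theorem norm_coeff_eq (ht : HasTrigForm V τ α f lam n c) (h : IsFirstEigenpairs V τ α f lam)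
    (i j : Fin J) : ‖c i‖ = ‖c j‖ := by
  have := h.norm_eq i j
  rw [ht.innerV_eq, ht.innerV_eq, if_pos rfl, if_pos rfl, mul_right_inj' Real.pi_ne_zero,
    real_inner_self_eq_norm_sq, real_inner_self_eq_norm_sq] at this
  exact (sq_eq_sq₀ (norm_nonneg _) (norm_nonneg _)).1 this

theorem freq_le_iff (ht : HasTrigForm V τ α f lam n c) (hα : 0 < α) {m : ℕ} (hm : 0 < m)
    (j : Fin J) : multiplier τ α m ≤ lam j ↔ n j ≤ m :=
  ht.lam_eq j ▸ (multiplier_strictAntiOn τ hα).le_iff_ge hm (ht.freq_pos j)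

theorem freq_monotone (ht : HasTrigForm V τ α f lam n c) (hα : 0 < α)
    (h : IsFirstEigenpairs V τ α f lam) : Monotone n := fun i j hij =>
  (ht.freq_le_iff hα (ht.freq_pos j) i).1 (ht.lam_eq j ▸ h.antitone hij)

theorem card_fiber_le_two (ht : HasTrigForm V τ α f lam n c) (h : IsFirstEigenpairs V τ α f lam)
    (m : ℕ) : (Finset.univ.filter fun j => n j = m).card ≤ 2 := by
  rw [← Fintype.card_subtype, ← Complex.finrank_real_complex]
  exact card_le_finrank_of_orthogonal (v := fun j : {j // n j = m} => c j)
    (fun j => ht.coeff_ne_zero j) fun i j hij =>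
      ht.inner_coeff_eq_zero h (Subtype.coe_ne_coe.2 hij) (i.2.trans j.2.symm)

theorem two_le_card_fiber (ht : HasTrigForm V τ α f lam n c) (hV : Continuous V) (hα : 0 < α)
    (h : IsFirstEigenpairs V τ α f lam) {m : ℕ} {j : Fin J} (hm : 0 < m) (hmj : m < n j) :
    2 ≤ (Finset.univ.filter fun i => n i = m).card := by
  by_contra! hlt
  rw [← Fintype.card_subtype, ← Complex.finrank_real_complex] at hlt
  obtain ⟨w, hw, horth⟩ := exists_ne_zero_forall_inner_eq_zero hlt
    fun i : {i // n i = m} => c i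
  refine hmj.not_ge ((ht.freq_le_iff hα hm j).1
    (h.first _ _ (isEigenpair_trig hV τ hα.le hm.ne' hw) (fun i => ?_) j))
  rw [innerV_trig hm.ne' (ht.ae_eq i) .rfl]
  split_ifs with hi
  · rw [horth ⟨i, hi⟩, mul_zero]
  · rfl

theorem freq_eq (ht : HasTrigForm V τ α f lam n c) (hV : Continuous V) (hα : 0 < α)
    (h : IsFirstEigenpairs V τ α f lam) : n = fun j : Fin J => (j : ℕ) / 2 + 1 :=
  funext <| eq_half_add_one_of_card_fiber (ht.freq_monotone hα h) ht.freq_pos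
    (ht.card_fiber_le_two h) fun _ _ hm hmj => ht.two_le_card_fiber hV hα h hm hmj

theorem exists_sum_sq_trig_eq (ht : HasTrigForm V τ α f lam (fun j => (j : ℕ) / 2 + 1) c)
    (h : IsFirstEigenpairs V τ α f lam) (hJ : Even J) :
    ∃ C : ℝ, ∀ x, ∑ j : Fin J, lam j *
      (((j / 2 + 1 : ℕ) : ℝ)⁻¹ * trig (j / 2 + 1 : ℕ) (Complex.I * c j) x) ^ 2 = C := by
  obtain ⟨K, rfl⟩ := exists_eq_mul_left_of_dvd hJ.two_dvd
  have hdiv (k : Fin K) (l : Fin 2) : (finProdFinEquiv (k, l) : ℕ) / 2 = k := by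
    simp only [finProdFinEquiv_apply_val]
    lia
  refine ⟨∑ k : Fin K, multiplier τ α (k + 1 : ℕ) *
    (((k + 1 : ℕ) : ℝ)⁻¹ ^ 2 * ‖c (finProdFinEquiv (k, 0))‖ ^ 2), fun x => ?_⟩
  rw [← finProdFinEquiv.sum_comp, Fintype.sum_prod_type]
  refine Finset.sum_congr rfl fun k _ => ?_
  simp only [ht.lam_eq, hdiv, mul_pow, ← Finset.mul_sum]
  rw [sum_sq_trig_of_orthogonal (Fintype.card_fin 2) (fun l => ?_) fun l l' hl => ?_]
  · rw [norm_mul, Complex.norm_I, one_mul, ht.norm_coeff_eq h]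
  · exact (inner_I_mul_I_mul _ _).trans
      (ht.inner_coeff_eq_zero h (by simpa using hl) (by simp only [hdiv]))

end HasTrigForm

end FirstEigenpairs

/-! ### The Poisson equation -/

theorem HasWeakDeriv.sub {φ g φ' g' : Torus → ℝ} (h' : HasWeakDeriv φ' g')
    (h : HasWeakDeriv φ g) : HasWeakDeriv (φ' - φ) (g' - g) := by
  have hmul {w ψ : Torus → ℝ} (hw : Integrable w) (hψ : Continuous ψ) :
      Integrable fun x => w x * ψ x := by
    simpa only [mul_comm, memLp_one_iff_integrable] using
      memLp_continuous_mul hψ (memLp_one_iff_integrable.2 hw)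
  refine ⟨h'.1.sub h.1, h'.2.1.sub h.2.1, fun ψ hψ => ?_⟩
  have hψc := hψ.continuous
  have hψc' := hψ.hasTorusDeriv.continuous_deriv
  simp only [Pi.sub_apply, sub_mul]
  rw [integral_sub (hmul h'.1 hψc') (hmul h.1 hψc'),
    integral_sub (hmul h'.2.1 hψc) (hmul h.2.1 hψc), h'.2.2 ψ hψ, h.2.2 ψ hψ]
  ring

theorem HasWeakDeriv.integral_eq_zero {φ g : Torus → ℝ} (h : HasWeakDeriv φ g) :
    ∫ x, g x = 0 := by
  simpa [torusDeriv] using h.2.2 _ (isSmooth_const 1)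

/-- The probability measure with density proportional to `exp (V + U)`, the reciprocal of the
density of `gibbs V U`. -/
noncomputable def dualGibbs (V U : Torus → ℝ) : Measure Torus :=
  volume.tilted fun x => V x + U x

/-- The normalization constant of `dualGibbs V U`. -/
noncomputable def dualPartitionFn (V U : Torus → ℝ) : ℝ := ∫ x, Real.exp (V x + U x)

/-- `G` is a potential for the source `f` of the Poisson equation, `-G' = exp (-V) f`. The equation
at the bias `U` is then `(exp (-V - U) φ')' = G'`. -/
def IsFlux (V f G : Torus → ℝ) : Prop :=
  ∃ h, HasTorusDeriv G h ∧ f =ᵐ[volume] fun x => -(Real.exp (V x) * h x)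

theorem integral_trig_eq_zero {n : ℤ} (hn : n ≠ 0) (c : ℂ) : ∫ x, trig n c x = 0 := by
  have := (hasTorusDeriv_trig n (-Complex.I * c)).hasWeakDeriv.integral_eq_zero
  rw [integral_const_mul] at this
  simpa [hn, ← mul_assoc] using this

section Poisson

variable {V U f φ g φ' g' G : Torus → ℝ}

theorem integral_gibbs (V U h : Torus → ℝ) :
    ∫ x, h x ∂(gibbs V U) = (partitionFn V U)⁻¹ * ∫ x, Real.exp (-V x - U x) * h x :=
  integral_tilted_eq_inv_mul _ h

theorem integral_dualGibbs (V U h : Torus → ℝ) :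
    ∫ x, h x ∂(dualGibbs V U) = (dualPartitionFn V U)⁻¹ * ∫ x, Real.exp (V x + U x) * h x :=
  integral_tilted_eq_inv_mul _ h

theorem partitionFn_pos (hV : Continuous V) (hU : Continuous U) : 0 < partitionFn V U :=
  integral_exp_pos (integrable_of_continuous (by fun_prop))

theorem dualPartitionFn_pos (hV : Continuous V) (hU : Continuous U) : 0 < dualPartitionFn V U :=
  integral_exp_pos (integrable_of_continuous (by fun_prop))

instance isFiniteMeasure_gibbs (V U : Torus → ℝ) : IsFiniteMeasure (gibbs V U) := by
  unfold gibbs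
  infer_instance

theorem isProbabilityMeasure_gibbs (hV : Continuous V) (hU : Continuous U) :
    IsProbabilityMeasure (gibbs V U) :=
  isProbabilityMeasure_tilted (integrable_of_continuous (by fun_prop))

theorem isProbabilityMeasure_dualGibbs (hV : Continuous V) (hU : Continuous U) :
    IsProbabilityMeasure (dualGibbs V U) :=
  isProbabilityMeasure_tilted (integrable_of_continuous (by fun_prop))

theorem exp_neg_sub_mul_exp_add_mul (v u t : ℝ) :
    Real.exp (-v - u) * (Real.exp (v + u) * t) = t := by
  rw [← neg_add', exp_neg_mul_exp_mul]

theorem IsFlux.continuous (hG : IsFlux V f G) : Continuous G :=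
  hG.choose_spec.1.continuous

theorem IsFlux.integral_gibbs_zero (hG : IsFlux V f G) : ∫ x, f x ∂(gibbs V 0) = 0 := by
  obtain ⟨h, hGh, hf⟩ := hG
  have hae : (fun x => Real.exp (-V x - (0 : Torus → ℝ) x) * f x) =ᵐ[volume] fun x => -h x :=
    hf.mono fun x hx => by
      simp only [hx, Pi.zero_apply, sub_zero, mul_neg, exp_neg_mul_exp_mul]
  rw [integral_gibbs, integral_congr_ae hae, integral_neg, hGh.hasWeakDeriv.integral_eq_zero,
    neg_zero, mul_zero]

theorem IsFlux.observable {J : ℕ} {f G : Fin J → Torus → ℝ} (hG : ∀ j, IsFlux V (f j) (G j))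
    (lam u : Fin J → ℝ) : IsFlux V (observable lam f u) (observable lam G u) := by
  choose h hGh hf using hG
  refine ⟨_, .sum fun j _ => (hGh j).const_mul (Real.sqrt (lam j) * u j), ?_⟩
  filter_upwards [ae_all_iff.2 hf] with x hx
  rw [BiasedLangevin.observable, Finset.mul_sum, ← Finset.sum_neg_distrib]
  refine Finset.sum_congr rfl fun j _ => ?_
  rw [hx j]
  ring

theorem IsFlux.isPoissonSolution (hG : IsFlux V f G) {c : ℝ}
    (hφ : HasTorusDeriv φ fun x => Real.exp (V x + U x) * (G x + c))
    (h0 : ∫ x, φ x ∂(gibbs V U) = 0) :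
    IsPoissonSolution V U f φ fun x => Real.exp (V x + U x) * (G x + c) where
  memLp := memLp_of_continuous hφ.continuous 2
  mean_zero := h0
  weakDeriv := hφ.hasWeakDeriv
  memLp_deriv := memLp_of_continuous hφ.continuous_deriv 2
  weak_eq ψ hψ := by
    rw [hG.integral_gibbs_zero, integral_gibbs, integral_gibbs]
    obtain ⟨h, hGh, hf⟩ := hG
    congr 1
    calc ∫ x, Real.exp (-V x - U x) * (Real.exp (V x + U x) * (G x + c) * torusDeriv ψ x)
      _ = ∫ x, (G x + c) * torusDeriv ψ x := by
        simp only [mul_assoc, exp_neg_sub_mul_exp_add_mul]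
      _ = ∫ x, -(h x * ψ x) := by
        rw [(hGh.add_const c).integral_mul hψ.hasTorusDeriv, integral_neg]
      _ = ∫ x, Real.exp (-V x - U x) * ((f x - 0) * Real.exp (U x) * ψ x) := by
        refine integral_congr_ae (hf.mono fun x hx => ?_)
        dsimp only
        rw [hx, ← exp_neg_sub_mul_exp_add_mul (V x) (U x) (-(h x * ψ x)), Real.exp_add (V x)]
        ring

theorem IsFlux.exists_isPoissonSolution (hG : IsFlux V f G) (hV : Continuous V)
    (hU : Continuous U) : ∃ φ, IsPoissonSolution V U f φ fun x =>
      Real.exp (V x + U x) * (G x - ∫ y, G y ∂(dualGibbs V U)) := by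
  have hGc := hG.continuous
  have hprob := isProbabilityMeasure_gibbs hV hU
  have hdual := isProbabilityMeasure_dualGibbs hV hU
  have hmean : ∫ x, Real.exp (V x + U x) * (G x - ∫ y, G y ∂(dualGibbs V U)) = 0 := by
    have : ∫ x, (G x - ∫ y, G y ∂(dualGibbs V U)) ∂(dualGibbs V U) = 0 := by
      rw [integral_sub (integrable_of_continuous hGc) (integrable_const _), integral_const,
        probReal_univ, one_smul, sub_self]
    rw [integral_dualGibbs] at this
    exact (mul_eq_zero.1 this).resolve_left (inv_ne_zero (dualPartitionFn_pos hV hU).ne')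
  obtain ⟨φ, hφ⟩ := exists_hasTorusDeriv (by fun_prop) hmean
  refine ⟨_, hG.isPoissonSolution (c := -∫ y, G y ∂(dualGibbs V U))
    (hφ.add_const (-∫ x, φ x ∂(gibbs V U))) ?_⟩
  rw [integral_add (integrable_of_continuous hφ.continuous) (integrable_const _), integral_const,
    probReal_univ, one_smul, add_neg_cancel]

namespace IsPoissonSolution

theorem sub (h' : IsPoissonSolution V U f φ' g') (h : IsPoissonSolution V U f φ g)
    (hV : Continuous V) (hU : Continuous U) :
    IsPoissonSolution V U (fun _ => 0) (φ' - φ) (g' - g) where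
  memLp := h'.memLp.sub h.memLp
  mean_zero := by
    have := isProbabilityMeasure_gibbs hV hU
    simp only [Pi.sub_apply]
    rw [integral_sub (h'.memLp.integrable one_le_two) (h.memLp.integrable one_le_two),
      h'.mean_zero, h.mean_zero, sub_zero]
  weakDeriv := h'.weakDeriv.sub h.weakDeriv
  memLp_deriv := h'.memLp_deriv.sub h.memLp_deriv
  weak_eq ψ hψ := by
    have := isProbabilityMeasure_gibbs hV hU
    have hψ2 : MemLp (torusDeriv ψ) 2 (gibbs V U) :=
      memLp_of_continuous hψ.hasTorusDeriv.continuous_deriv 2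
    simp only [Pi.sub_apply, sub_mul, integral_zero, sub_zero, zero_mul]
    refine (integral_sub (h'.memLp_deriv.integrable_mul hψ2)
      (h.memLp_deriv.integrable_mul hψ2)).trans ?_
    exact sub_eq_zero.2 ((h'.weak_eq ψ hψ).trans (h.weak_eq ψ hψ).symm)

theorem deriv_ae_eq_zero (h : IsPoissonSolution V U (fun _ => 0) φ g) (hV : Continuous V)
    (hU : Continuous U) : g =ᵐ[volume] 0 := by
  obtain ⟨c, hc⟩ := ae_eq_const_of_integral_mul_torusDeriv
    (w := fun x => Real.exp (-V x - U x) * g x)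
    (memLp_continuous_mul (by fun_prop) ((memLp_tilted_iff (by fun_prop)).1 h.memLp_deriv))
    fun ψ hψ => by
      have := h.weak_eq ψ hψ
      rw [integral_gibbs] at this
      simpa only [integral_zero, sub_zero, zero_mul, mul_assoc, mul_eq_zero, inv_eq_zero,
        (partitionFn_pos hV hU).ne', false_or] using this
  have hg : g =ᵐ[volume] fun x => Real.exp (V x + U x) * c := hc.mono fun x hx => by
    simp only [← hx, mul_left_comm (Real.exp (V x + U x)), exp_neg_sub_mul_exp_add_mul]
  have hc0 : dualPartitionFn V U * c = 0 := by
    rw [dualPartitionFn, ← integral_mul_const, ← integral_congr_ae hg,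
      h.weakDeriv.integral_eq_zero]
  rw [mul_eq_zero_iff_left (dualPartitionFn_pos hV hU).ne'] at hc0
  exact hg.trans (.of_forall fun x => by simp only [hc0, mul_zero, Pi.zero_apply])

theorem ae_eq_zero (h : IsPoissonSolution V U (fun _ => 0) φ g) (hV : Continuous V)
    (hU : Continuous U) : φ =ᵐ[volume] 0 := by
  have hg := h.deriv_ae_eq_zero hV hU
  obtain ⟨c, hc⟩ := ae_eq_const_of_integral_mul_torusDeriv
    ((memLp_tilted_iff (by fun_prop)).1 h.memLp) fun ψ hψ => by
      rw [h.weakDeriv.2.2 ψ hψ, neg_eq_zero]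
      exact integral_eq_zero_of_ae (hg.mono fun x hx => by simp only [hx, Pi.zero_apply, zero_mul])
  have := isProbabilityMeasure_gibbs hV hU
  have habs : gibbs V U ≪ volume := tilted_absolutelyContinuous _ _
  have hc0 := integral_congr_ae (habs.ae_le hc)
  rw [h.mean_zero, integral_const, probReal_univ, one_smul] at hc0
  rwa [← hc0] at hc

theorem unique (h' : IsPoissonSolution V U f φ' g') (h : IsPoissonSolution V U f φ g)
    (hV : Continuous V) (hU : Continuous U) : φ' =ᵐ[volume] φ ∧ g' =ᵐ[volume] g :=
  ⟨((h'.sub h hV hU).ae_eq_zero hV hU).mono fun _ => sub_eq_zero.1,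
    ((h'.sub h hV hU).deriv_ae_eq_zero hV hU).mono fun _ => sub_eq_zero.1⟩

end IsPoissonSolution

theorem IsFlux.asymVar_eq (hG : IsFlux V f G) (hV : Continuous V) (hU : Continuous U) :
    asymVar V f U = 2 * partitionFn V U * dualPartitionFn V U / partitionFn V 0 ^ 2 *
      Var[G; dualGibbs V U] := by
  obtain ⟨φ, hφ⟩ := hG.exists_isPoissonSolution hV hU
  have hex : ∃ p : (Torus → ℝ) × (Torus → ℝ), IsPoissonSolution V U f p.1 p.2 := ⟨(φ, _), hφ⟩
  have hsq : ∫ x, Real.exp (-V x - U x) * hex.choose.2 x ^ 2 =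
      ∫ x, Real.exp (V x + U x) * (G x - ∫ y, G y ∂(dualGibbs V U)) ^ 2 := by
    refine integral_congr_ae ?_
    filter_upwards [(hex.choose_spec.unique hφ hV hU).2] with x hx
    rw [hx, ← exp_neg_sub_mul_exp_add_mul (V x) (U x)
      (Real.exp (V x + U x) * (G x - ∫ y, G y ∂(dualGibbs V U)) ^ 2)]
    ring
  have hZ := (partitionFn_pos hV hU).ne'
  have hZ' := (dualPartitionFn_pos hV hU).ne'
  rw [asymVar, dif_pos hex, integral_gibbs, hsq, variance_eq_integral
    hG.continuous.measurable.aemeasurable,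
    integral_dualGibbs V U fun x => (G x - ∫ y, G y ∂(dualGibbs V U)) ^ 2]
  field_simp

end Poisson

/-! ### Averaging over the Gaussian coefficients -/

section Averaging

variable {J : ℕ}

theorem memLp_eval_stdGaussian (i : Fin J) : MemLp (fun u : Fin J → ℝ => u i) 2 (stdGaussian J) :=
  (memLp_id_gaussianReal 2).comp_measurePreserving
    (measurePreserving_eval (fun _ : Fin J => gaussianReal 0 1) i)

theorem integral_eval_mul_eval_stdGaussian (i j : Fin J) :
    ∫ u, u i * u j ∂(stdGaussian J) = if i = j then 1 else 0 := by
  split_ifs with hij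
  · subst hij
    have hvar := variance_of_integral_eq_zero (μ := gaussianReal 0 1) aemeasurable_id
      integral_id_gaussianReal
    rw [variance_id_gaussianReal] at hvar
    exact (integral_comp_eval (μ := fun _ : Fin J => gaussianReal 0 1) (i := i)
      (f := fun t => t * t) (by fun_prop)).trans (by simpa [sq] using hvar.symm)
  · have hmean (k : Fin J) : ∫ u, u k ∂(stdGaussian J) = 0 :=
      integral_eval.trans integral_id_gaussianReal
    have hindep : iIndepFun (fun (k : Fin J) (u : Fin J → ℝ) => u k) (stdGaussian J) :=
      iIndepFun_pi (X := fun _ t => t) fun _ => measurable_id'.aemeasurable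
    rw [(hindep.indepFun hij).integral_fun_mul_eq_mul_integral
      (memLp_eval_stdGaussian i).aestronglyMeasurable
      (memLp_eval_stdGaussian j).aestronglyMeasurable, hmean, zero_mul]

theorem integrable_quadratic_stdGaussian (q : Fin J → Fin J → ℝ) :
    Integrable (fun u => ∑ i, ∑ j, u i * u j * q i j) (stdGaussian J) :=
  integrable_finsetSum _ fun i _ => integrable_finsetSum _ fun j _ =>
    ((memLp_eval_stdGaussian i).integrable_mul (memLp_eval_stdGaussian j)).mul_const _

theorem integral_quadratic_stdGaussian (q : Fin J → Fin J → ℝ) :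
    ∫ u, ∑ i, ∑ j, u i * u j * q i j ∂(stdGaussian J) = ∑ i, q i i := by
  have hint (i j : Fin J) : Integrable (fun u => u i * u j * q i j) (stdGaussian J) :=
    ((memLp_eval_stdGaussian i).integrable_mul (memLp_eval_stdGaussian j)).mul_const _
  rw [integral_finsetSum _ fun i _ => integrable_finsetSum _ fun j _ => hint i j]
  refine Finset.sum_congr rfl fun i _ => ?_
  simp only [integral_finsetSum _ fun j _ => hint i j, integral_mul_const,
    integral_eval_mul_eval_stdGaussian, ite_mul, one_mul, zero_mul, Finset.sum_ite_eq,
    Finset.mem_univ, if_true]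

variable {V U : Torus → ℝ} {f G : Fin J → Torus → ℝ} {lam : Fin J → ℝ}

theorem variance_observable {μ : Measure Torus} [IsProbabilityMeasure μ]
    (hG : ∀ j, MemLp (G j) 2 μ) (lam u : Fin J → ℝ) :
    Var[observable lam G u; μ] = ∑ i, ∑ j, u i * u j *
      (Real.sqrt (lam i) * Real.sqrt (lam j) * cov[G i, G j; μ]) := by
  unfold observable
  rw [variance_fun_sum fun j => (hG j).const_mul _]
  simp only [covariance_const_mul_left, covariance_const_mul_right]
  refine Finset.sum_congr rfl fun i _ => Finset.sum_congr rfl fun j _ => ?_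
  ring

theorem asymVar_observable (hG : ∀ j, IsFlux V (f j) (G j)) (hV : Continuous V)
    (hU : Continuous U) (lam u : Fin J → ℝ) :
    asymVar V (observable lam f u) U =
      2 * partitionFn V U * dualPartitionFn V U / partitionFn V 0 ^ 2 *
        ∑ i, ∑ j, u i * u j *
          (Real.sqrt (lam i) * Real.sqrt (lam j) * cov[G i, G j; dualGibbs V U]) := by
  have := isProbabilityMeasure_dualGibbs hV hU
  rw [(IsFlux.observable hG lam u).asymVar_eq hV hU,
    variance_observable fun j => memLp_of_continuous (hG j).continuous 2]

theorem integrable_asymVar_observable (hG : ∀ j, IsFlux V (f j) (G j)) (hV : Continuous V)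
    (hU : Continuous U) (lam : Fin J → ℝ) :
    Integrable (fun u => asymVar V (observable lam f u) U) (stdGaussian J) := by
  simp only [asymVar_observable hG hV hU]
  exact (integrable_quadratic_stdGaussian _).const_mul _

theorem avgAsymVar_eq_sum_variance (hG : ∀ j, IsFlux V (f j) (G j)) (hV : Continuous V)
    (hU : Continuous U) (hlam : ∀ j, 0 ≤ lam j) :
    avgAsymVar V lam f U = 2 * partitionFn V U * dualPartitionFn V U / partitionFn V 0 ^ 2 *
      ∑ j, lam j * Var[G j; dualGibbs V U] := by
  simp only [avgAsymVar, asymVar_observable hG hV hU]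
  rw [integral_const_mul, integral_quadratic_stdGaussian]
  simp only [Real.mul_self_sqrt (hlam _),
    covariance_self (hG _).continuous.measurable.aemeasurable]

theorem sum_mul_variance_of_sum_sq_eq {Ω ι : Type*} [Fintype ι] [MeasurableSpace Ω]
    {μ : Measure Ω} [IsProbabilityMeasure μ] {X : ι → Ω → ℝ} (hX : ∀ j, MemLp (X j) 2 μ)
    {lam : ι → ℝ} {C : ℝ} (hC : ∀ x, ∑ j, lam j * X j x ^ 2 = C) :
    ∑ j, lam j * Var[X j; μ] = C - ∑ j, lam j * (∫ x, X j x ∂μ) ^ 2 := by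
  have hsq : ∑ j, lam j * ∫ x, X j x ^ 2 ∂μ = C := by
    simp_rw [← integral_const_mul]
    rw [← integral_finsetSum _ fun j _ => (hX j).integrable_sq.const_mul _]
    simp_rw [hC]
    rw [integral_const, probReal_univ, one_smul]
  rw [← hsq, ← Finset.sum_sub_distrib]
  refine Finset.sum_congr rfl fun j _ => ?_
  rw [variance_eq_sub (hX j), mul_sub]
  rfl

end Averaging

/-! ### The critical point -/

section CriticalPoint

variable {J : ℕ} {V δ : Torus → ℝ}

theorem partitionFn_neg_add (V δ : Torus → ℝ) (ε : ℝ) :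
    partitionFn V (fun x => -V x + ε * δ x) = ∫ x, Real.exp (-ε * δ x) := by
  unfold partitionFn
  congr with x
  ring_nf

theorem dualPartitionFn_neg_add (V δ : Torus → ℝ) (ε : ℝ) :
    dualPartitionFn V (fun x => -V x + ε * δ x) = ∫ x, Real.exp (ε * δ x) := by
  unfold dualPartitionFn
  congr with x
  ring_nf

theorem integral_dualGibbs_neg_add (V δ g : Torus → ℝ) (ε : ℝ) :
    ∫ x, g x ∂(dualGibbs V fun x => -V x + ε * δ x) =
      (∫ x, Real.exp (ε * δ x))⁻¹ * ∫ x, Real.exp (ε * δ x) * g x := by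
  rw [integral_dualGibbs, dualPartitionFn_neg_add]
  simp only [add_neg_cancel_left]

theorem hasDerivAt_integral_exp (hδ : Continuous δ) (t : ℝ) :
    HasDerivAt (fun ε : ℝ => ∫ x, Real.exp (ε * δ x)) (∫ x, δ x * Real.exp (t * δ x)) t := by
  simpa only [mul_one] using hasDerivAt_integral_exp_mul hδ (h := fun _ => 1) continuous_const t

theorem hasDerivAt_partitionFn_mul_dualPartitionFn (V : Torus → ℝ) (hδ : Continuous δ) :
    HasDerivAt (fun ε : ℝ => partitionFn V (fun x => -V x + ε * δ x) *
      dualPartitionFn V (fun x => -V x + ε * δ x)) 0 0 := by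
  simp only [partitionFn_neg_add, dualPartitionFn_neg_add]
  have hA := hasDerivAt_integral_exp hδ 0
  have hA' : HasDerivAt (fun ε : ℝ => ∫ x, Real.exp (-ε * δ x)) _ 0 :=
    (hasDerivAt_integral_exp hδ (-0)).comp (0 : ℝ) (hasDerivAt_neg 0)
  refine (hA'.mul hA).congr_deriv ?_
  simp only [neg_zero]
  ring

theorem hasDerivAt_sq_integral_dualGibbs (V : Torus → ℝ) (hδ : Continuous δ) {g : Torus → ℝ}
    (hg : Continuous g) (hmean : ∫ x, g x = 0) :
    HasDerivAt (fun ε : ℝ => (∫ x, g x ∂(dualGibbs V fun x => -V x + ε * δ x)) ^ 2) 0 0 := by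
  simp only [integral_dualGibbs_neg_add]
  have hA : ∫ x, Real.exp (0 * δ x) ≠ 0 :=
    (integral_exp_pos (integrable_of_continuous (by fun_prop))).ne'
  refine ((((hasDerivAt_integral_exp hδ 0).inv hA).mul
    (hasDerivAt_integral_exp_mul hδ hg 0)).pow 2).congr_deriv ?_
  simp [hmean]

theorem hasDerivAt_avgAsymVar_neg {f G : Fin J → Torus → ℝ} {lam : Fin J → ℝ}
    (hG : ∀ j, IsFlux V (f j) (G j)) (hV : Continuous V) (hδ : Continuous δ)
    (hlam : ∀ j, 0 ≤ lam j) (hmean : ∀ j, ∫ x, G j x = 0) {C : ℝ}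
    (hC : ∀ x, ∑ j, lam j * G j x ^ 2 = C) :
    HasDerivAt (fun ε : ℝ => avgAsymVar V lam f fun x => -V x + ε * δ x) 0 0 := by
  have hcont (ε : ℝ) : Continuous fun x => -V x + ε * δ x := by fun_prop
  have heq (ε : ℝ) := by
    have := isProbabilityMeasure_dualGibbs hV (hcont ε)
    exact (avgAsymVar_eq_sum_variance hG hV (hcont ε) hlam).trans (congrArg _
      (sum_mul_variance_of_sum_sq_eq (fun j => memLp_of_continuous (hG j).continuous 2) hC))
  simp only [heq, mul_assoc (2 : ℝ)]
  have hsum := HasDerivAt.fun_sum (u := Finset.univ) fun j _ =>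
    (hasDerivAt_sq_integral_dualGibbs V hδ (hG j).continuous (hmean j)).const_mul (lam j)
  refine ((((hasDerivAt_partitionFn_mul_dualPartitionFn V hδ).const_mul 2).div_const
    (partitionFn V 0 ^ 2)).mul (hsum.const_sub C)).congr_deriv ?_
  simp

end CriticalPoint

/-! ### Trigonometric fluxes -/

section Trig

variable {V f : Torus → ℝ} {n : ℕ} {c : ℂ}

theorem isFlux_trig (hn : n ≠ 0) (hf : f =ᵐ[volume] fun x => Real.exp (V x) * trig n c x) :
    IsFlux V f fun x => (n : ℝ)⁻¹ * trig n (Complex.I * c) x := by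
  refine ⟨_, (hasTorusDeriv_trig n _).const_mul _, hf.trans (.of_forall fun x => ?_)⟩
  have hn' : (n : ℝ) ≠ 0 := Nat.cast_ne_zero.2 hn
  simp [trig, ← mul_assoc, hn']
  ring

theorem hasTorusDeriv_inv_sq_mul_trig (hn : n ≠ 0) (c : ℂ) :
    HasTorusDeriv (fun x => ((n : ℝ) ^ 2)⁻¹ * trig n c x)
      fun x => (n : ℝ)⁻¹ * trig n (Complex.I * c) x := by
  have hn' : (n : ℝ) ≠ 0 := Nat.cast_ne_zero.2 hn
  convert (hasTorusDeriv_trig n c).const_mul ((n : ℝ) ^ 2)⁻¹ using 2 with x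
  rw [Int.cast_natCast]
  field_simp

theorem isPoissonSolution_neg_trig (hn : n ≠ 0)
    (hf : f =ᵐ[volume] fun x => Real.exp (V x) * trig n c x) :
    IsPoissonSolution V (fun x => -V x) f (fun x => ((n : ℝ) ^ 2)⁻¹ * trig n c x)
      fun x => (n : ℝ)⁻¹ * trig n (Complex.I * c) x := by
  have := (isFlux_trig hn hf).isPoissonSolution (U := fun x => -V x) (c := 0)
    (by simpa using hasTorusDeriv_inv_sq_mul_trig hn c)
    (by simp [integral_gibbs, integral_const_mul, integral_trig_eq_zero, hn])
  simpa using this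

end Trig

end BiasedLangevin

open BiasedLangevin MeasureTheory in
theorem mainTheorem10_general (V : Torus → ℝ) (hV : Continuous V) (τ α : ℝ) (hα : 0 < α)
    (J : ℕ) (hJ : Even J) (f : Fin J → Torus → ℝ) (lam : Fin J → ℝ)
    (hf : IsFirstEigenpairs V τ α f lam) :
    (∀ U : Torus → ℝ, Continuous U →
      (∀ u : Fin J → ℝ, ∃ φ g : Torus → ℝ, IsPoissonSolution V U (observable lam f u) φ g ∧
        ∀ φ' g' : Torus → ℝ, IsPoissonSolution V U (observable lam f u) φ' g' →
          φ' =ᵐ[volume] φ ∧ g' =ᵐ[volume] g) ∧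
      Integrable (fun u => asymVar V (observable lam f u) U) (stdGaussian J)) ∧
    (∀ δU : Torus → ℝ, Continuous δU →
      HasDerivAt (fun ε : ℝ => avgAsymVar V lam f (fun x => -V x + ε * δU x)) 0 0) ∧
    (∃ a b : Fin J → ℝ,
      (∀ j, f j =ᵐ[volume] fun x => Real.exp (V x) *
        (a j * sinMode (j / 2 + 1) x + b j * cosMode (j / 2 + 1) x)) ∧
      (∀ j, IsPoissonSolution V (fun x => -V x) (f j)
        (fun x => (((j / 2 + 1 : ℕ) : ℝ) ^ 2)⁻¹ *
          (a j * sinMode (j / 2 + 1) x + b j * cosMode (j / 2 + 1) x))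
        (fun x => ((j / 2 + 1 : ℕ) : ℝ)⁻¹ *
          (a j * cosMode (j / 2 + 1) x - b j * sinMode (j / 2 + 1) x))) ∧
      ∃ C : ℝ, ∀ x : Torus, ∑ j, lam j * (((j / 2 + 1 : ℕ) : ℝ)⁻¹ *
          (a j * cosMode (j / 2 + 1) x - b j * sinMode (j / 2 + 1) x)) ^ 2 = C) := by
  obtain ⟨n, c, ht⟩ := hf.exists_hasTrigForm hV hα
  obtain rfl := ht.freq_eq hV hα hf
  obtain ⟨C, hC⟩ := ht.exists_sum_sq_trig_eq hf hJ
  have hG (j) := isFlux_trig (Nat.succ_ne_zero _) (ht.ae_eq j)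
  have hmean (j : Fin J) :
      ∫ x, ((j / 2 + 1 : ℕ) : ℝ)⁻¹ * trig (j / 2 + 1 : ℕ) (Complex.I * c j) x = 0 := by
    rw [integral_const_mul, integral_trig_eq_zero (by lia), mul_zero]
  have hlam (j) : 0 ≤ lam j := ht.lam_eq j ▸ multiplier_nonneg τ α _
  refine ⟨fun U hU => ⟨fun u => ?_, integrable_asymVar_observable hG hV hU lam⟩,
    fun δU hδ => hasDerivAt_avgAsymVar_neg hG hV hδ hlam hmean hC,
    fun j => -(c j).im, fun j => (c j).re, ?_⟩
  · obtain ⟨φ, hφ⟩ := (IsFlux.observable hG lam u).exists_isPoissonSolution hV hU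
    exact ⟨φ, _, hφ, fun φ' g' h' => h'.unique hφ hV hU⟩
  · simp only [← trig_natCast, ← trig_natCast_I_mul]
    exact ⟨ht.ae_eq, fun j => isPoissonSolution_neg_trig (Nat.succ_ne_zero _) (ht.ae_eq j), C, hC⟩

open BiasedLangevin MeasureTheory in
theorem mainTheorem10 (V : Torus → ℝ) (hV : IsSmooth V) (τ α : ℝ) (hα : 0 < α)
    (J : ℕ) (hJ : Even J) (hJ0 : 0 < J) (f : Fin J → Torus → ℝ) (lam : Fin J → ℝ)
    (hf : IsFirstEigenpairs V τ α f lam) :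
    -- the averaged asymptotic variance is well defined at every smooth biasing potential
    (∀ U : Torus → ℝ, IsSmooth U →
      (∀ u : Fin J → ℝ, ∃ φ g : Torus → ℝ, IsPoissonSolution V U (observable lam f u) φ g ∧
        ∀ φ' g' : Torus → ℝ, IsPoissonSolution V U (observable lam f u) φ' g' →
          φ' =ᵐ[volume] φ ∧ g' =ᵐ[volume] g) ∧
      Integrable (fun u => asymVar V (observable lam f u) U) (stdGaussian J)) ∧
    -- `U = -V` is a critical point
    IsCriticalPoint (avgAsymVar V lam f) (fun x => -V x) ∧
    -- explicit Poisson solutions at `U = -V`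
    (∃ a b : Fin J → ℝ,
      (∀ j, f j =ᵐ[volume] fun x => Real.exp (V x) *
        (a j * sinMode (j / 2 + 1) x + b j * cosMode (j / 2 + 1) x)) ∧
      (∀ j, IsPoissonSolution V (fun x => -V x) (f j)
        (fun x => (((j / 2 + 1 : ℕ) : ℝ) ^ 2)⁻¹ *
          (a j * sinMode (j / 2 + 1) x + b j * cosMode (j / 2 + 1) x))
        (fun x => ((j / 2 + 1 : ℕ) : ℝ)⁻¹ *
          (a j * cosMode (j / 2 + 1) x - b j * sinMode (j / 2 + 1) x))) ∧
      ∃ C : ℝ, ∀ x : Torus, ∑ j, lam j * (((j / 2 + 1 : ℕ) : ℝ)⁻¹ *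
          (a j * cosMode (j / 2 + 1) x - b j * sinMode (j / 2 + 1) x)) ^ 2 = C) := by
  obtain ⟨hsol, hcrit, hexplicit⟩ := mainTheorem10_general V hV.continuous τ α hα J hJ f lam hf
  exact ⟨fun U hU => hsol U hU.continuous, fun δU hδ => hcrit δU hδ.continuous, hexplicit⟩
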